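/- Let $L$ be a finite geometric lattice, that is, a finite lattice (with least element $0$) in which every non-zero element is a join of atoms (elements covering $0$) and which is semimodular: for all $a,b\in L$, if $a$ covers $a\wedge b$ then $a\vee b$ covers $b$. For $a\in L$ let the rank $r(a)$ be the maximum length of a chain of $L$ with greatest element $a$, where a chain with $k+1$ elements has length $k$. Let $\mu_L$ be the Möbius function of $L$, that is, the inverse of the zeta function in the incidence algebra of $L$: $\mu_L(a,a)=1$, $\mu_L(a,b)=-\sum_{a\le x<b}\mu_L(a,x)$ if $a<b$, and $\mu_L(a,b)=0$ if $a\not\le b$. Then for all $a,b\in L$ with $a\le b$, $$(-1)^{r(b)-r(a)}\,\mu_L(a,b)>0 .$$ In particular $\mu_L(a,b)\neq 0$, and its sign is $(-1)^{r(b)-r(a)}$. -/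

import Mathlib

/-- A lattice with zero is geometric if it is a semimodular point-lattice: every element is the
join of a set of atoms (the zero element being the empty join), and `b ⋖ a ⊔ b` whenever
`a ⊓ b ⋖ a`. -/
class IsGeometricLattice (L : Type*) [Lattice L] [OrderBot L] : Prop extends
    IsAtomistic L, IsUpperModularLattice L

/-- The rank of an element: the maximum length (number of steps) of a chain ending at it.
`Order.height` is the supremum of these lengths in `ℕ∞`; it is finite in a finite order. -/
noncomputable def latticeRank {L : Type*} [Preorder L] (a : L) : ℕ :=
  (Order.height a).toNat

/-- In a finite order the rank is monotone, so `latticeRank b - latticeRank a` is not truncated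
when `a ≤ b`. -/
theorem latticeRank_mono {L : Type*} [PartialOrder L] [Finite L] {a b : L} (h : a ≤ b) :
    latticeRank a ≤ latticeRank b := by
  have := Fintype.ofFinite L
  have hb : Order.height b ≤ (Fintype.card L : ℕ∞) :=
    Order.height_le fun p _ => by exact_mod_cast p.length_lt_card.le
  exact ENat.toNat_le_toNat (Order.height_mono h) (ne_top_of_le_ne_top (ENat.natCast_ne_top _) hb)

/-! Induction on `b`. For a cover `c ≤ b` of `a`, Weisner's theorem writes `μ(a, b)` as minus the
sum of `μ(a, x)` over the `x ≠ b` in `[a, b]` with `x ⊔ c = b`. Semimodularity forces `x ⋖ b`, so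
every such `x` has rank one less than `b` and all terms have the same sign; a complement of `c`
shows that the sum is nonempty. -/

open IncidenceAlgebra in
/-- **Weisner's theorem**: if `a < c ≤ b` then the sum of `μ(a, x)` over all `x ∈ [a, b]` with
`x ⊔ c = b` vanishes. -/
theorem sum_mu_filter_sup_eq_zero {L : Type*} [Lattice L] [LocallyFiniteOrder L] [Finite L]
    [DecidableEq L] {a c : L} (hac : a < c) (b : L) (hcb : c ≤ b) :
    ∑ x ∈ Finset.Icc a b with x ⊔ c = b, mu ℤ a x = 0 := by
  induction b using WellFoundedLT.induction with
  | ind b ih =>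
    have htotal : ∑ x ∈ Finset.Icc a b, mu ℤ a x = 0 := by
      rw [sum_Icc_mu_right, if_neg (hac.trans_le hcb).ne]
    have hmaps : ∀ x ∈ Finset.Icc a b, x ⊔ c ∈ Finset.Icc c b := fun x hx =>
      Finset.mem_Icc.2 ⟨le_sup_right, sup_le (Finset.mem_Icc.1 hx).2 hcb⟩
    -- Group by the value of `x ⊔ c`: fibres over `z < b` vanish by induction.
    rw [← Finset.sum_fiberwise_of_maps_to hmaps,
      Finset.sum_eq_single_of_mem b (Finset.mem_Icc.2 ⟨hcb, le_rfl⟩)] at htotal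
    · exact htotal
    · intro z hz hzb
      obtain ⟨hcz, hzb'⟩ := Finset.mem_Icc.1 hz
      rw [← ih z (lt_of_le_of_ne hzb' hzb) hcz]
      refine Finset.sum_congr ?_ fun _ _ => rfl
      ext x
      simp only [Finset.mem_filter, Finset.mem_Icc]
      constructor
      · rintro ⟨⟨h, -⟩, rfl⟩
        exact ⟨⟨h, le_sup_left⟩, rfl⟩
      · rintro ⟨⟨h, h'⟩, h''⟩
        exact ⟨⟨h, h'.trans hzb'⟩, h''⟩

/-- Jordan–Dedekind: distinct covers `c`, `d` of `a` are both covered by `c ⊔ d`, so by induction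
from the top they have equal coheight. -/
theorem CovBy.coheight_eq {L : Type*} [Lattice L] [Finite L] [IsUpperModularLattice L]
    {a c : L} (hac : a ⋖ c) : Order.coheight a = Order.coheight c + 1 := by
  induction a using WellFoundedGT.induction generalizing c with
  | ind a ih =>
    refine le_antisymm ?_ (Order.coheight_add_one_le hac.lt)
    cases hn : Order.coheight c with
    | top => simp
    | coe n =>
      have hbound : ∀ y > a, Order.coheight y < ((n + 1 : ℕ) : ℕ∞) := by
        intro y hy
        obtain ⟨d, had, hdy⟩ := exists_covBy_le_of_lt hy
        suffices Order.coheight d = n by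
          refine (Order.coheight_anti hdy).trans_lt ?_
          rw [this]
          exact_mod_cast n.lt_succ_self
        by_cases hcd : c = d
        · rw [← hcd, hn]
        have hinf : c ⊓ d = a := by
          refine (hac.eq_or_eq (le_inf hac.le had.le) inf_le_left).resolve_right fun h => ?_
          exact hcd ((had.eq_or_eq hac.le (inf_eq_left.1 h)).resolve_left hac.ne')
        have hd : d ⋖ c ⊔ d := covBy_sup_of_inf_covBy_left (hinf.symm ▸ hac)
        have hc : c ⋖ c ⊔ d := covBy_sup_of_inf_covBy_right (hinf.symm ▸ had)
        rw [ih d had.lt hd, ← ih c hac.lt hc, hn]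
      exact_mod_cast Order.coheight_le_coe_iff.2 hbound

theorem height_ne_top_of_finite {L : Type*} [PartialOrder L] [Finite L] (a : L) :
    Order.height a ≠ ⊤ := by
  have := Fintype.ofFinite L
  exact ne_top_of_le_ne_top (ENat.natCast_ne_top (Fintype.card L))
    (Order.height_le fun p _ => by exact_mod_cast p.length_lt_card.le)

theorem coheight_ne_top_of_finite {L : Type*} [PartialOrder L] [Finite L] (a : L) :
    Order.coheight a ≠ ⊤ :=
  height_ne_top_of_finite (OrderDual.toDual a)

/-- Transfers gradedness from coheight to height: going down to a `z ⋖ x` of height one less raises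
the coheight by one. -/
theorem height_add_coheight_eq_coheight_bot {L : Type*} [Lattice L] [OrderBot L] [Finite L]
    [IsUpperModularLattice L] (x : L) :
    Order.height x + Order.coheight x = Order.coheight (⊥ : L) := by
  induction x using WellFoundedLT.induction with
  | ind x ih =>
    obtain rfl | hx := eq_or_ne x ⊥
    · simp
    obtain ⟨n, hn⟩ := ENat.ne_top_iff_exists.1 (height_ne_top_of_finite x)
    cases n with
    | zero => exact absurd (isMin_iff_eq_bot.1 (Order.height_eq_zero.1 hn.symm)) hx
    | succ n =>
      push_cast at hn
      obtain ⟨-, ⟨y, hyx, hy⟩, hle⟩ := Order.height_eq_coe_add_one_iff.1 hn.symm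
      obtain ⟨z, hyz, hzx⟩ := exists_le_covBy_of_lt hyx
      have hz : Order.height z = n :=
        le_antisymm (hle z hzx.lt) (hy ▸ Order.height_mono hyz)
      rw [← ih z hzx.lt, hz, hzx.coheight_eq, ← hn, add_assoc, add_comm 1]

theorem CovBy.latticeRank_eq {L : Type*} [Lattice L] [OrderBot L] [Finite L]
    [IsUpperModularLattice L] {x b : L} (h : x ⋖ b) :
    latticeRank b = latticeRank x + 1 := by
  have hheight : Order.height b = Order.height x + 1 := by
    have heq := (height_add_coheight_eq_coheight_bot b).trans
      (height_add_coheight_eq_coheight_bot x).symm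
    rw [h.coheight_eq, add_comm (Order.coheight b), ← add_assoc] at heq
    exact ENat.add_left_injective_of_ne_top (coheight_ne_top_of_finite b) heq
  rw [latticeRank, latticeRank, hheight, ENat.toNat_add (height_ne_top_of_finite x) (by simp)]
  simp

/-- In a finite geometric lattice, every cover `c` of `a` below `b` has a relative complement
in `[a, b]`. -/
theorem exists_sup_eq_of_covBy {L : Type*} [Lattice L] [OrderBot L] [Finite L]
    [IsGeometricLattice L] {a b c : L} (hac : a ⋖ c) (hcb : c ≤ b) :
    ∃ x, a ≤ x ∧ x < b ∧ x ⊔ c = b := by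
  obtain ⟨x, ⟨⟨hax, hxb, hcx⟩, hmax⟩⟩ :=
    (Set.toFinite {x : L | a ≤ x ∧ x ≤ b ∧ ¬ c ≤ x}).exists_maximal
      ⟨a, le_rfl, hac.le.trans hcb, hac.lt.not_ge⟩
  refine ⟨x, hax, lt_of_le_of_ne hxb fun h => hcx (h ▸ hcb), ?_⟩
  refine le_antisymm (sup_le hxb hcb) ?_
  -- An atom `p ≤ b` not below `x ⊔ c` would give `x ⋖ p ⊔ x`, and `c ≤ p ⊔ x` by maximality of `x`;
  -- then `x ⊔ c` is `x` or `p ⊔ x`, both absurd.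
  obtain ⟨s, hs, hatom⟩ := IsAtomistic.isLUB_atoms b
  refine hs.2 fun p hp => ?_
  by_contra hpx
  have hp' := hatom p hp
  have hpnx : ¬ p ≤ x := fun h => hpx (h.trans le_sup_left)
  have hcov : x ⋖ p ⊔ x := by
    refine covBy_sup_of_inf_covBy_left ?_
    rw [(hp'.not_le_iff_disjoint.1 hpnx).eq_bot]
    exact hp'.bot_covBy
  have hcpx : c ≤ p ⊔ x := by
    by_contra hc
    exact hcov.lt.not_ge (hmax ⟨hax.trans hcov.le, sup_le (hs.1 hp) hxb, hc⟩ hcov.le)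
  obtain h | h := hcov.eq_or_eq (le_sup_left : x ≤ x ⊔ c) (sup_le hcov.le hcpx)
  · exact hcx (sup_eq_left.1 h)
  · exact hpx (h ▸ le_sup_left)

theorem mainTheorem5 {L : Type*} [Lattice L] [OrderBot L] [Finite L] [LocallyFiniteOrder L]
    [DecidableEq L] [IsGeometricLattice L] (a b : L) (hab : a ≤ b) :
    0 < (-1 : ℤ) ^ (latticeRank b - latticeRank a) * IncidenceAlgebra.mu ℤ a b := by
  induction b using WellFoundedLT.induction with
  | ind b ih =>
    obtain rfl | hlt := hab.eq_or_lt
    · simp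
    obtain ⟨c, hac, hcb⟩ := exists_covBy_le_of_lt hlt
    have hsum := sum_mu_filter_sup_eq_zero hac.lt b hcb
    have hb : b ∈ (Finset.Icc a b).filter (fun x => x ⊔ c = b) := by
      simpa [hab] using hcb
    rw [← Finset.add_sum_erase _ _ hb] at hsum
    rw [eq_neg_of_add_eq_zero_left hsum, ← Finset.sum_neg_distrib, Finset.mul_sum]
    refine Finset.sum_pos (fun x hx => ?_) ?_
    · simp only [Finset.mem_erase, Finset.mem_filter, Finset.mem_Icc] at hx
      obtain ⟨hxb, ⟨hax, hxb'⟩, hxc⟩ := hx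
      have hinf : c ⊓ x = a := by
        refine (hac.eq_or_eq (le_inf hac.le hax) inf_le_left).resolve_right fun h => hxb ?_
        rw [← hxc, sup_eq_left.2 (inf_eq_left.1 h)]
      have hcov : x ⋖ b := by
        have h : x ⋖ c ⊔ x := covBy_sup_of_inf_covBy_left (hinf.symm ▸ hac)
        rwa [sup_comm, hxc] at h
      have hpos := ih x hcov.lt hax
      rw [hcov.latticeRank_eq, Nat.sub_add_comm (latticeRank_mono hax), pow_succ]
      simpa using hpos
    · obtain ⟨x, hax, hxb, hxc⟩ := exists_sup_eq_of_covBy hac hcb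
      exact ⟨x, by simp [hxb.ne, hax, hxb.le, hxc]⟩
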